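/- Let $q$ and $a$ be independent indeterminates. Write $(x;q)_0=1$ and $(x;q)_k=(1-x)(1-xq)\cdots(1-xq^{k-1})$ for $k\geqslant 1$, $(x_1,\ldots,x_m;q)_k=(x_1;q)_k\cdots(x_m;q)_k$, $[m]=1+q+\cdots+q^{m-1}$, and let $\Phi_n(q)$ be the $n$-th cyclotomic polynomial in $q$. For rational functions $A,B\in\mathbb{Q}(q,a)$ and a polynomial $P\in\mathbb{Z}[q,a]$, the congruence $A\equiv B\pmod{P}$ means that $A-B=PN/D$ for some $N,D\in\mathbb{Z}[q,a]$ with $D\neq 0$ relatively prime to $P$ (that is, $D$ and $P$ have no non-unit common divisor in $\mathbb{Z}[q,a]$). **Theorem.** Let $n$ be a positive odd integer, and for $k\geqslant 0$ let $$ c_q(k)=(-1)^kq^{k^2}[4k+1]\frac{(aq,q/a,q;q^2)_k}{(aq^2,q^2/a,q^2;q^2)_k}. $$ Then $$ \sum_{k=0}^{n-1}\sum_{j=0}^{k}c_q(j)c_q(k-j)\equiv q^{(n-1)^2/2}[n]^2\pmod{[n]\Phi_n(q)(1-aq^n)(a-q^n)}. $$ -/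

import Mathlib

open Polynomial

noncomputable section

namespace QCongruence

/-- The `q`-shifted factorial `(x; q)_k = (1 - x)(1 - x q) ⋯ (1 - x q^(k-1))`. -/
def qPoch {R : Type*} [CommRing R] (x q : R) (k : ℕ) : R :=
  ∏ i ∈ Finset.range k, (1 - x * q ^ i)

/-- The `q`-integer `[m] = 1 + q + ⋯ + q^(m-1)`. -/
def qInt {R : Type*} [CommRing R] (q : R) (m : ℕ) : R :=
  ∑ i ∈ Finset.range m, q ^ i

/-- The ring `ℤ[q, a]` of integer polynomials in two indeterminates: the inner variable is `q`,
the outer variable is `a`. -/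
abbrev Poly : Type := ℤ[X][X]

/-- The field `ℚ(q, a)` of rational functions in two indeterminates, as the field of fractions
of `ℤ[q, a]`. -/
abbrev Rat2 : Type := FractionRing Poly

/-- The indeterminate `q` as a polynomial. -/
def qP : Poly := C X

/-- The indeterminate `a` as a polynomial. -/
def aP : Poly := X

/-- The indeterminate `q` as a rational function. -/
def qF : Rat2 := algebraMap Poly Rat2 qP

/-- The indeterminate `a` as a rational function. -/
def aF : Rat2 := algebraMap Poly Rat2 aP

/-- Congruence of rational functions modulo a polynomial: `A ≡ B (mod P)` means that `A - B` can be
written as a fraction whose numerator is divisible by `P` and whose denominator is relatively prime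
to `P` (no non-unit common divisor in `ℤ[q, a]`). -/
def Congr (P : Poly) (A B : Rat2) : Prop :=
  ∃ N D : Poly, D ≠ 0 ∧ IsRelPrime D P ∧
    A - B = algebraMap Poly Rat2 (P * N) / algebraMap Poly Rat2 D

/-- The term `c_q(k) = (-1)^k q^(k^2) [4k+1] (aq, q/a, q; q^2)_k / (aq^2, q^2/a, q^2; q^2)_k`. -/
def c {K : Type*} [Field K] (a q : K) (k : ℕ) : K :=
  (-1) ^ k * q ^ (k ^ 2) * qInt q (4 * k + 1) *
    ((qPoch (a * q) (q ^ 2) k * qPoch (q / a) (q ^ 2) k * qPoch q (q ^ 2) k) /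
      (qPoch (a * q ^ 2) (q ^ 2) k * qPoch (q ^ 2 / a) (q ^ 2) k * qPoch (q ^ 2) (q ^ 2) k))

/-- The modulus `[n] Φ_n(q) (1 - a q^n) (a - q^n)`. -/
def modulus (n : ℕ) : Poly :=
  qInt qP n * C (cyclotomic n ℤ) * (1 - aP * qP ^ n) * (aP - qP ^ n)

end QCongruence

end

/-! The modulus splits into pairwise coprime pieces: `Φ_d` for each proper divisor `d > 1` of `n`,
the square `Φ_n ^ 2`, and the two linear factors in `a`. `Congr.mul` glues the pieces, so each is
treated alone by specializing `q` or `a`.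

Linear factors: `c` is invariant under `a ↦ 1/a`, so only `a = q^n`, `n = 2N+1`, matters. There `c`
vanishes beyond `N`, so the triangle `i + j < n` may be replaced by the square `i, j ≤ N` and the
double sum is the square of a single sum. A telescoping relation between `a` and `a q^2` evaluates
that sum by induction on `N` (`sum_c_pow`).

`Φ_d` with `d = 2N+1` dividing `n`: at a primitive `d`-th root of unity, the terms factor as `c (d l
+ u) = γ l * c u`, vanish for `N < u < d`, and are antisymmetric under `u ↦ N - u`. The triangle
decomposes into full squares of blocks, each contributing a multiple of `(∑ c u)^2 = 0`.

`Φ_n ^ 2`: the double sum is `S^2 + 2T`, where `S` sums the terms up to `N` and `T` collects pairs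
with first index above `N`. Antisymmetry makes `S` divisible by `Φ_n`. Every summand of `T` carries
a factor `1 - q^n`; once it is removed, a second antisymmetry, about `(3N+1)/2`, supplies another
`Φ_n`. -/

noncomputable section

namespace QCongruence

/-! ### Term ratios and the contiguous relation in `a`. -/

section Ratio

variable {K : Type*} [Field K]

theorem qPoch_succ {R : Type*} [CommRing R] (x q : R) (k : ℕ) :
    qPoch x q (k + 1) = qPoch x q k * (1 - x * q ^ k) :=
  Finset.prod_range_succ _ _

theorem qPoch_succ' {R : Type*} [CommRing R] (x q : R) (k : ℕ) :
    qPoch x q (k + 1) = (1 - x) * qPoch (x * q) q k := by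
  simp only [qPoch, Finset.prod_range_succ', pow_zero, mul_one, mul_comm (1 - x)]
  exact congrArg (· * _) (Finset.prod_congr rfl fun i _ => by ring)

theorem qPoch_ne_zero {x q : K} {k : ℕ} (h : ∀ i < k, x * q ^ i ≠ 1) : qPoch x q k ≠ 0 :=
  Finset.prod_ne_zero_iff.2 fun i hi => sub_ne_zero.2 (h i (Finset.mem_range.1 hi)).symm

theorem qInt_eq {q : K} (hq : q ≠ 1) (m : ℕ) : qInt q m = (1 - q ^ m) / (1 - q) := by
  rw [eq_div_iff (sub_ne_zero.2 hq.symm), mul_comm]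
  exact mul_neg_geom_sum q m

/-- The quotient `b (t + 1) / b t`, where `b t = c a q t / [4t+1]`. -/
def ratio (a q : K) (t : ℕ) : K :=
  -q ^ (2 * t + 1) * ((1 - a * q ^ (2 * t + 1)) * (1 - q ^ (2 * t + 1) / a) * (1 - q ^ (2 * t + 1)) /
    ((1 - a * q ^ (2 * t + 2)) * (1 - q ^ (2 * t + 2) / a) * (1 - q ^ (2 * t + 2))))

/-- The term `c a q k` without its factor `[4k+1]`. -/
def b (a q : K) (k : ℕ) : K := ∏ t ∈ Finset.range k, ratio a q t

theorem b_succ (a q : K) (k : ℕ) : b a q (k + 1) = b a q k * ratio a q k :=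
  Finset.prod_range_succ _ _

theorem c_eq (a q : K) (k : ℕ) : c a q k = qInt q (4 * k + 1) * b a q k := by
  have h : b a q k = (-1) ^ k * q ^ (k ^ 2) *
      ((qPoch (a * q) (q ^ 2) k * qPoch (q / a) (q ^ 2) k * qPoch q (q ^ 2) k) /
      (qPoch (a * q ^ 2) (q ^ 2) k * qPoch (q ^ 2 / a) (q ^ 2) k * qPoch (q ^ 2) (q ^ 2) k)) := by
    induction k with
    | zero => simp [b, qPoch]
    | succ k ih =>
      rw [b_succ, ih, ratio]
      simp only [qPoch_succ, div_eq_mul_inv, mul_inv, ← pow_mul]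
      have e1 : a * q * q ^ (2 * k) = a * q ^ (2 * k + 1) := by ring
      have e2 : q * a⁻¹ * q ^ (2 * k) = q ^ (2 * k + 1) * a⁻¹ := by ring
      have e3 : q * q ^ (2 * k) = q ^ (2 * k + 1) := by ring
      have e4 : a * q ^ 2 * q ^ (2 * k) = a * q ^ (2 * k + 2) := by ring
      have e5 : q ^ 2 * a⁻¹ * q ^ (2 * k) = q ^ (2 * k + 2) * a⁻¹ := by ring
      have e6 : q ^ 2 * q ^ (2 * k) = q ^ (2 * k + 2) := by ring
      have e7 : (-1 : K) ^ (k + 1) * q ^ (k + 1) ^ 2 =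
        (-1) ^ k * q ^ k ^ 2 * -q ^ (2 * k + 1) := by ring
      rw [e1, e2, e3, e4, e5, e6, e7]
      generalize (1 - a * q ^ (2 * k + 2))⁻¹ = x
      generalize (1 - q ^ (2 * k + 2) * a⁻¹)⁻¹ = y
      generalize (1 - q ^ (2 * k + 2))⁻¹ = z
      ring
  rw [h, c]; ring

/-- The factors with `a` and `1/a` swap places; this reduces `1 - a q^n` to the case `a = q^n`. -/
theorem c_inv (a q : K) (k : ℕ) : c a⁻¹ q k = c a q k := by
  simp only [c, div_inv_eq_mul]
  rw [show a⁻¹ * q = q / a by ring, show a⁻¹ * q ^ 2 = q ^ 2 / a by ring, mul_comm q a,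
    mul_comm (q ^ 2) a, mul_comm (qPoch (q / a) _ _), mul_comm (qPoch (q ^ 2 / a) _ _)]

/-- A WZ-type relation between the terms for the parameters `a` and `a q ^ 2`, in summed form. -/
theorem sum_contiguous {a q : K} (hq : q ≠ 0) (hq1 : q ≠ 1) (ha : a ≠ 0)
    (h1 : ∀ i : ℕ, a * (q ^ 2) ^ i ≠ 1) (h2 : ∀ i : ℕ, (q ^ 2) ^ i ≠ a)
    (h3 : ∀ i : ℕ, (q ^ 2) ^ (i + 1) ≠ 1) (m : ℕ) :
    ∑ k ∈ Finset.range (m + 1), ((1 - a) * c (a * q ^ 2) q k + a * (1 - a * q ^ 2) * c a q k) =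
      (1 - a ^ 2 * q ^ 2) * (-1) ^ m * q ^ (m ^ 2 + 2 * m) * qInt q (2 * m + 1) *
      ((qPoch (a * q ^ 3) (q ^ 2) m * qPoch (q / a) (q ^ 2) m * qPoch q (q ^ 2) m) /
      (qPoch (a * q ^ 4) (q ^ 2) m * qPoch (q ^ 2 / a) (q ^ 2) m * qPoch (q ^ 2) (q ^ 2) m)) := by
  have hs : (1 : K) - q ≠ 0 := sub_ne_zero.2 hq1.symm
  have ha1 : (1 : K) - a ≠ 0 := sub_ne_zero.2 fun h => h1 0 (by simp [← h])
  have ha1' : a - 1 ≠ 0 := fun h => ha1 (by linear_combination -h)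
  induction m with
  | zero => simp [c, qInt, qPoch]; ring
  | succ m ih =>
    rw [Finset.sum_range_succ, ih]
    clear ih
    have n1 : (1 : K) - a * q ^ 2 ≠ 0 := sub_ne_zero.2 fun h => h1 1 (by simp [← h])
    have n2 : qPoch (a * q ^ 4) (q ^ 2) m ≠ 0 := qPoch_ne_zero fun i _ h => h1 (i + 2) (by
      rw [← h]; ring)
    have n3 : qPoch (q ^ 2 / a) (q ^ 2) m ≠ 0 := qPoch_ne_zero fun i _ h => h2 (i + 1) (by
      field_simp at h; rw [← h]; ring)
    have n4 : qPoch (q ^ 2) (q ^ 2) m ≠ 0 := qPoch_ne_zero fun i _ h => h3 i (by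
      rw [← h]; ring)
    have n5 : (1 : K) - a * q ^ 4 * (q ^ 2) ^ m ≠ 0 :=
      sub_ne_zero.2 fun h => h1 (m + 2) (by rw [h]; ring)
    have n6 : a - q ^ 2 * (q ^ 2) ^ m ≠ 0 := sub_ne_zero.2 fun h => h2 (m + 1) (by rw [h]; ring)
    have n7 : (1 : K) - q ^ 2 * (q ^ 2) ^ m ≠ 0 := sub_ne_zero.2 fun h => h3 m (by rw [h]; ring)
    -- Peeling factors off the front or the back of the products expresses both terms through the
    -- same six products of length `m` as the right-hand side, leaving a rational identity.
    have E1 : c (a * q ^ 2) q (m + 1) = (-1) ^ (m + 1) * q ^ ((m + 1) ^ 2) * qInt q (4 * (m + 1) + 1) *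
        ((qPoch (a * q ^ 3) (q ^ 2) m * (1 - a * q ^ 3 * (q ^ 2) ^ m) *
          ((1 - 1 / (a * q)) * qPoch (q / a) (q ^ 2) m) *
          (qPoch q (q ^ 2) m * (1 - q * (q ^ 2) ^ m))) /
        (qPoch (a * q ^ 4) (q ^ 2) m * (1 - a * q ^ 4 * (q ^ 2) ^ m) *
          ((1 - 1 / a) * qPoch (q ^ 2 / a) (q ^ 2) m) *
          (qPoch (q ^ 2) (q ^ 2) m * (1 - q ^ 2 * (q ^ 2) ^ m)))) := by
      rw [c, qPoch_succ (a * q ^ 2 * q), qPoch_succ' (q / (a * q ^ 2)), qPoch_succ q,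
        qPoch_succ (a * q ^ 2 * q ^ 2), qPoch_succ' (q ^ 2 / (a * q ^ 2)), qPoch_succ (q ^ 2)]
      rw [show q / (a * q ^ 2) * q ^ 2 = q / a by field_simp,
        show q ^ 2 / (a * q ^ 2) * q ^ 2 = q ^ 2 / a by field_simp,
        show q / (a * q ^ 2) = 1 / (a * q) by field_simp,
        show q ^ 2 / (a * q ^ 2) = 1 / a by field_simp]
      ring_nf
    have E2 : c a q (m + 1) = (-1) ^ (m + 1) * q ^ ((m + 1) ^ 2) * qInt q (4 * (m + 1) + 1) *
        (((1 - a * q) * qPoch (a * q ^ 3) (q ^ 2) m *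
          (qPoch (q / a) (q ^ 2) m * (1 - q / a * (q ^ 2) ^ m)) *
          (qPoch q (q ^ 2) m * (1 - q * (q ^ 2) ^ m))) /
        ((1 - a * q ^ 2) * qPoch (a * q ^ 4) (q ^ 2) m *
          (qPoch (q ^ 2 / a) (q ^ 2) m * (1 - q ^ 2 / a * (q ^ 2) ^ m)) *
          (qPoch (q ^ 2) (q ^ 2) m * (1 - q ^ 2 * (q ^ 2) ^ m)))) := by
      rw [c, qPoch_succ' (a * q), qPoch_succ (q / a), qPoch_succ q,
        qPoch_succ' (a * q ^ 2), qPoch_succ (q ^ 2 / a), qPoch_succ (q ^ 2)]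
      ring_nf
    rw [E1, E2, qPoch_succ (a * q ^ 3), qPoch_succ (q / a), qPoch_succ q,
        qPoch_succ (a * q ^ 4), qPoch_succ (q ^ 2 / a), qPoch_succ (q ^ 2),
        qInt_eq hq1, qInt_eq hq1, qInt_eq hq1]
    clear E1 E2
    rw [show q ^ (4 * (m + 1) + 1) = ((q ^ 2) ^ m) ^ 2 * q ^ 5 by ring,
      show q ^ (2 * (m + 1) + 1) = (q ^ 2) ^ m * q ^ 3 by ring,
      show q ^ (2 * m + 1) = (q ^ 2) ^ m * q by ring,
      show q ^ (m + 1) ^ 2 = q ^ (m ^ 2) * (q ^ 2) ^ m * q by ring,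
      show q ^ ((m + 1) ^ 2 + 2 * (m + 1)) = q ^ (m ^ 2) * ((q ^ 2) ^ m) ^ 2 * q ^ 3 by ring,
      show q ^ (m ^ 2 + 2 * m) = q ^ (m ^ 2) * (q ^ 2) ^ m by ring, pow_succ (-1 : K) m,
      show 1 - 1 / a = (a - 1) / a by field_simp,
      show ∀ x y : K, 1 - x / a * y = (a - x * y) / a from fun x y => by field_simp]
    generalize qPoch (a * q ^ 4) (q ^ 2) m = p1 at *
    generalize qPoch (q ^ 2 / a) (q ^ 2) m = p2 at *
    generalize qPoch (q ^ 2) (q ^ 2) m = p3 at *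
    generalize qPoch (a * q ^ 3) (q ^ 2) m = p4 at *
    generalize qPoch (q / a) (q ^ 2) m = p5 at *
    generalize qPoch q (q ^ 2) m = p6 at *
    generalize q ^ (m ^ 2) = w at *
    generalize (-1 : K) ^ m = s at *
    generalize (q ^ 2) ^ m = z at *
    clear h1 h2 h3
    field_simp
    ring

end Ratio

/-! ### Rearrangements of sums over the triangle `i + j < n`. -/

section Sums

variable {R : Type*} [CommRing R]

theorem sum_range_mul (f : ℕ → R) (d m : ℕ) :
    ∑ i ∈ Finset.range (d * m), f i =
      ∑ l ∈ Finset.range m, ∑ u ∈ Finset.range d, f (d * l + u) := by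
  induction m with
  | zero => simp
  | succ m ih => rw [Nat.mul_succ, Finset.sum_range_add, ih, Finset.sum_range_succ]

/-- The square `i, j ≤ N` lies inside the triangle `i + j ≤ 2N`; in the rest exactly one index
exceeds `N`, and the two cases are mirror images. -/
theorem convolution_sum_eq (f : ℕ → R) (N : ℕ) :
    ∑ i ∈ Finset.range (2 * N + 1), ∑ j ∈ Finset.range (2 * N + 1 - i), f i * f j =
      (∑ i ∈ Finset.range (N + 1), f i) ^ 2 +
        2 * ∑ s ∈ Finset.range N, f (N + 1 + s) * ∑ j ∈ Finset.range (N - s), f j := by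
  have h1 : ∀ i ∈ Finset.range (N + 1), ∑ j ∈ Finset.range (2 * N + 1 - i), f i * f j =
      f i * ∑ j ∈ Finset.range (N + 1), f j + ∑ s ∈ Finset.range (N - i), f i * f (N + 1 + s) := by
    intro i hi
    rw [Finset.mem_range] at hi
    rw [show 2 * N + 1 - i = N + 1 + (N - i) by omega, Finset.sum_range_add, Finset.mul_sum]
  have h2 : ∀ s ∈ Finset.range N, ∑ j ∈ Finset.range (2 * N + 1 - (N + 1 + s)),
      f (N + 1 + s) * f j = f (N + 1 + s) * ∑ j ∈ Finset.range (N - s), f j := by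
    intro s _
    rw [show 2 * N + 1 - (N + 1 + s) = N - s by omega, Finset.mul_sum]
  have h3 : ∑ i ∈ Finset.range (N + 1), ∑ s ∈ Finset.range (N - i), f i * f (N + 1 + s) =
      ∑ s ∈ Finset.range N, f (N + 1 + s) * ∑ j ∈ Finset.range (N - s), f j := by
    simp_rw [Finset.mul_sum]
    rw [Finset.sum_comm' (t' := Finset.range N) (s' := fun s => Finset.range (N - s))]
    · simp_rw [mul_comm]
    · intro x y
      simp only [Finset.mem_range]
      omega
  conv_lhs => rw [show 2 * N + 1 = N + 1 + N by ring]
  rw [Finset.sum_range_add]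
  simp only [show N + 1 + N = 2 * N + 1 by ring]
  rw [Finset.sum_congr rfl h1, Finset.sum_congr rfl h2, Finset.sum_add_distrib, h3,
    ← Finset.sum_mul]
  ring

/-- Nonzero terms have residues `u, v ≤ N`, so `u + v` never carries into the next block and the
triangle condition depends only on the block indices. Each pair of blocks then contributes a
multiple of `(∑ e)^2`. -/
theorem convolution_sum_blocks {γ e : ℕ → R} {N m : ℕ}
    (h : ∀ u, N < u → u < 2 * N + 1 → e u = 0) (hsum : ∑ u ∈ Finset.range (N + 1), e u = 0) :
    ∑ i ∈ Finset.range ((2 * N + 1) * m), ∑ j ∈ Finset.range ((2 * N + 1) * m - i),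
      (γ (i / (2 * N + 1)) * e (i % (2 * N + 1))) *
        (γ (j / (2 * N + 1)) * e (j % (2 * N + 1))) = 0 := by
  have hsum' : ∑ u ∈ Finset.range (2 * N + 1), e u = 0 := by
    rw [← hsum]
    refine (Finset.sum_subset (Finset.range_subset_range.2 (by omega)) fun j hj hj' => ?_).symm
    rw [Finset.mem_range] at hj hj'
    exact h j (by omega) (by omega)
  have key : ∀ i ∈ Finset.range ((2 * N + 1) * m), ∑ j ∈ Finset.range ((2 * N + 1) * m - i),
      (γ (i / (2 * N + 1)) * e (i % (2 * N + 1))) *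
        (γ (j / (2 * N + 1)) * e (j % (2 * N + 1))) =
      ∑ j ∈ Finset.range ((2 * N + 1) * m), if i + j < (2 * N + 1) * m then
        (γ (i / (2 * N + 1)) * e (i % (2 * N + 1))) *
        (γ (j / (2 * N + 1)) * e (j % (2 * N + 1))) else 0 := by
    intro i hi
    rw [← Finset.sum_filter]
    congr 1
    ext j
    simp only [Finset.mem_range, Finset.mem_filter]
    omega
  rw [Finset.sum_congr rfl key, sum_range_mul]
  refine Finset.sum_eq_zero fun l _ => ?_
  simp_rw [sum_range_mul _ (2 * N + 1) m]
  rw [Finset.sum_comm]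
  refine Finset.sum_eq_zero fun l' _ => ?_
  have : ∀ u ∈ Finset.range (2 * N + 1), ∀ v ∈ Finset.range (2 * N + 1),
      (if (2 * N + 1) * l + u + ((2 * N + 1) * l' + v) < (2 * N + 1) * m then
        (γ (((2 * N + 1) * l + u) / (2 * N + 1)) * e (((2 * N + 1) * l + u) % (2 * N + 1))) *
        (γ (((2 * N + 1) * l' + v) / (2 * N + 1)) * e (((2 * N + 1) * l' + v) % (2 * N + 1)))
        else 0) = (if l + l' < m then γ l * γ l' else 0) * (e u * e v) := by
    intro u hu v hv
    rw [Finset.mem_range] at hu hv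
    rw [Nat.mul_add_mod, Nat.mul_add_mod, Nat.mod_eq_of_lt hu, Nat.mod_eq_of_lt hv,
      Nat.mul_add_div (by omega), Nat.mul_add_div (by omega), Nat.div_eq_of_lt hu,
      Nat.div_eq_of_lt hv, add_zero, add_zero]
    by_cases hu' : N < u
    · simp [h u hu' hu]
    by_cases hv' : N < v
    · simp [h v hv' hv]
    have hiff : (2 * N + 1) * l + u + ((2 * N + 1) * l' + v) < (2 * N + 1) * m ↔ l + l' < m := by
      constructor
      · intro hlt
        by_contra hcon
        have := Nat.mul_le_mul_left (2 * N + 1) (not_lt.1 hcon)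
        rw [mul_add] at this
        omega
      · intro hlt
        have := Nat.mul_le_mul_left (2 * N + 1) (Nat.succ_le_of_lt hlt)
        rw [Nat.mul_succ, mul_add] at this
        omega
    simp only [hiff]
    split_ifs <;> ring
  rw [Finset.sum_congr rfl fun u hu => Finset.sum_congr rfl (this u hu)]
  simp_rw [← Finset.mul_sum, hsum', mul_zero, Finset.sum_const_zero, mul_zero]

end Sums

/-! ### Evaluation at `a = q^(2N+1)`. -/

section PowerOfQ

variable {K : Type*} [Field K] {q : K}

theorem c_pow_eq_zero (hq : q ≠ 0) {N k : ℕ} (h : N < k) : c (q ^ (2 * N + 1)) q k = 0 := by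
  have : qPoch (q / q ^ (2 * N + 1)) (q ^ 2) k = 0 :=
    Finset.prod_eq_zero (Finset.mem_range.2 h) (by field_simp; ring)
  simp [c, this]

theorem sum_c_pow (hq : q ≠ 0) (hq1 : ∀ m : ℕ, 0 < m → q ^ m ≠ 1) (N : ℕ) :
    ∀ m, N < m → ∑ k ∈ Finset.range m, c (q ^ (2 * N + 1)) q k =
      (-1) ^ N * q ^ (N ^ 2) * qInt q (2 * N + 1) := by
  have hq1' : q ≠ 1 := fun h => hq1 1 one_pos (by simp [h])
  induction N with
  | zero =>
    intro m hm
    rw [Finset.sum_eq_single_of_mem 0 (Finset.mem_range.2 hm) fun k _ hk =>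
      c_pow_eq_zero (N := 0) hq (Nat.pos_of_ne_zero hk)]
    simp [c, qInt, qPoch]
  | succ N ih =>
    intro m hm
    obtain ⟨m, rfl⟩ : ∃ m', m = m' + 1 := ⟨m - 1, by omega⟩
    have hne : ∀ i j : ℕ, i < j → q ^ j ≠ q ^ i := fun i j hij h => hq1 (j - i) (by omega) (by
      obtain ⟨k, rfl⟩ := Nat.exists_eq_add_of_lt hij
      rw [show i + k + 1 - i = k + 1 by omega]
      rw [add_assoc, pow_add] at h
      exact mul_left_cancel₀ (pow_ne_zero i hq) (by rw [h, mul_one]))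
    have H := sum_contiguous (a := q ^ (2 * N + 1)) hq hq1' (pow_ne_zero _ hq)
      (fun i => by rw [← pow_mul, ← pow_add]; exact hq1 _ (by omega))
      (fun i => by
        rw [← pow_mul]
        rcases lt_or_gt_of_ne (by omega : 2 * i ≠ 2 * N + 1) with h | h
        · exact (hne _ _ h).symm
        · exact hne _ _ h)
      (fun i => by rw [← pow_mul]; exact hq1 _ (by omega)) m
    -- For `m > N` the right-hand side of the contiguous relation contains the zero factor `1 - (q /
    -- q^(2N+1)) q^(2N)`, so the sums for `N` and `N + 1` are proportional.
    have hz : qPoch (q / q ^ (2 * N + 1)) (q ^ 2) m = 0 :=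
      Finset.prod_eq_zero (Finset.mem_range.2 (by omega : N < m)) (by field_simp; ring)
    rw [hz, Finset.sum_add_distrib, ← Finset.mul_sum, ← Finset.mul_sum, ih _ (by omega)] at H
    have hn : (1 : K) - q ^ (2 * N + 1) ≠ 0 := sub_ne_zero.2 (hq1 _ (by omega)).symm
    have hn' : (1 : K) - q ≠ 0 := sub_ne_zero.2 hq1'.symm
    refine mul_left_cancel₀ hn ?_
    rw [show q ^ (2 * (N + 1) + 1) = q ^ (2 * N + 1) * q ^ 2 by ring]
    rw [qInt_eq hq1'] at H ⊢
    simp only [mul_zero, zero_mul, zero_div] at H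
    rw [eq_neg_of_add_eq_zero_left H]
    field_simp
    ring

/-- The double sum at `a = q ^ (2N+1)`. -/
theorem convolution_sum_c_pow (hq : q ≠ 0) (hq1 : ∀ m : ℕ, 0 < m → q ^ m ≠ 1) (N : ℕ) :
    ∑ i ∈ Finset.range (2 * N + 1), ∑ j ∈ Finset.range (2 * N + 1 - i),
      c (q ^ (2 * N + 1)) q i * c (q ^ (2 * N + 1)) q j =
      q ^ (2 * N ^ 2) * qInt q (2 * N + 1) ^ 2 := by
  rw [convolution_sum_eq, Finset.sum_eq_zero (s := Finset.range N) fun s _ => by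
    rw [c_pow_eq_zero hq (by omega), zero_mul], mul_zero, add_zero, sum_c_pow hq hq1 N _ (Nat.lt_succ_self N), mul_pow, mul_pow, ← pow_mul, ← pow_mul,
    mul_comm N 2, pow_mul (-1 : K)]
  simp [mul_comm]

end PowerOfQ

/-! ### Antisymmetry of the terms at a root of unity. -/

section RootOfUnity

variable {K : Type*} [Field K] {a ζ : K}

/-- With `x = ζ^(2j+1)` the hypothesis says `ζ^(2j+2) = 1/x`. Each quotient such as `(1 - x)/(1 -
1/x) = -x` is a monomial, and altogether they give `x^4`. -/
theorem ratio_of_mul_eq_one {j : ℕ} (ha : a ≠ 0) (h1 : ∀ i : ℕ, a * ζ ^ i ≠ 1)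
    (h2 : ∀ i : ℕ, ζ ^ i ≠ a) (hj : ζ ^ (4 * j + 3) = 1) (hne : ζ ^ (2 * j + 2) ≠ 1) :
    ratio a ζ j = ζ ^ (4 * j + 1) := by
  have hx0 : ζ ^ (2 * j + 1) ≠ 0 := fun h => by
    rw [show 4 * j + 3 = (2 * j + 1) + (2 * j + 2) by ring, pow_add, h] at hj; simp at hj
  have hxy : ζ ^ (2 * j + 1) * ζ ^ (2 * j + 2) = 1 := by rw [← hj]; ring
  have e : ζ ^ (4 * j + 1) = (ζ ^ (2 * j + 1)) ^ 4 := by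
    linear_combination -ζ ^ (4 * j + 1) * hj
  have g1 := h1 (2 * j + 2)
  have g2 := h2 (2 * j + 2)
  rw [e, ratio]
  generalize ζ ^ (2 * j + 1) = x at *
  generalize ζ ^ (2 * j + 2) = y at *
  obtain rfl := eq_inv_of_mul_eq_one_right hxy
  have e1 : x - a ≠ 0 := fun h => g1 (by rw [← sub_eq_zero.1 h, mul_inv_cancel₀ hx0])
  have e2 : a * x - 1 ≠ 0 := fun h => g2 (eq_comm.1 (eq_inv_of_mul_eq_one_left (sub_eq_zero.1 h)))
  have e2' : x * a - 1 ≠ 0 := by rwa [mul_comm]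
  have e3 : x - 1 ≠ 0 := fun h => hne (by rw [sub_eq_zero.1 h, inv_one])
  field_simp
  ring

/-- The numerator arguments at `j` are inverse to the denominator arguments at `k`, and conversely,
so all factors cancel up to monomials. -/
theorem ratio_mul_ratio {j k : ℕ} (ha : a ≠ 0) (h1 : ∀ i : ℕ, a * ζ ^ i ≠ 1)
    (h2 : ∀ i : ℕ, ζ ^ i ≠ a) (hjk : ζ ^ (2 * j + 2 * k + 3) = 1) (hne : ζ ^ (2 * j + 1) ≠ 1)
    (hne' : ζ ^ (2 * j + 2) ≠ 1) : ratio a ζ k * ratio a ζ j * ζ ^ 4 = 1 := by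
  have hζ : ζ ≠ 0 := fun h => by simp [h] at hjk
  have hxy : ζ ^ (2 * j + 1) * ζ ^ (2 * k + 2) = 1 := by rw [← hjk]; ring
  have hyx : ζ ^ (2 * j + 2) * ζ ^ (2 * k + 1) = 1 := by rw [← hjk]; ring
  have e : ζ = ζ ^ (2 * j + 2) / ζ ^ (2 * j + 1) := by field_simp; ring
  have hx0 := pow_ne_zero (2 * j + 1) hζ
  have hy0 := pow_ne_zero (2 * j + 2) hζ
  have g1 := h1 (2 * j + 1)
  have g2 := h2 (2 * j + 1)
  have g3 := h1 (2 * j + 2)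
  have g4 := h2 (2 * j + 2)
  have e' : ζ ^ 4 = (ζ ^ (2 * j + 2) / ζ ^ (2 * j + 1)) ^ 4 := by rw [← e]
  rw [e', ratio, ratio]
  clear e e' h1 h2 hζ hjk
  generalize ζ ^ (2 * j + 1) = x at *
  generalize ζ ^ (2 * j + 2) = y at *
  generalize ζ ^ (2 * k + 1) = x' at *
  generalize ζ ^ (2 * k + 2) = y' at *
  obtain rfl := eq_inv_of_mul_eq_one_right hxy
  obtain rfl := eq_inv_of_mul_eq_one_right hyx
  have f1 : 1 - a * x ≠ 0 := sub_ne_zero.2 g1.symm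
  have f1' : a * x - 1 ≠ 0 := sub_ne_zero.2 g1
  have f2 : x - a ≠ 0 := sub_ne_zero.2 g2
  have f2' : a - x ≠ 0 := sub_ne_zero.2 g2.symm
  have f3 : 1 - a * y ≠ 0 := sub_ne_zero.2 g3.symm
  have f3' : a * y - 1 ≠ 0 := sub_ne_zero.2 g3
  have f1'' : 1 - x * a ≠ 0 := by rwa [mul_comm]
  have f1''' : x * a - 1 ≠ 0 := by rwa [mul_comm]
  have f3'' : 1 - y * a ≠ 0 := by rwa [mul_comm]
  have f3''' : y * a - 1 ≠ 0 := by rwa [mul_comm]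
  have f4 : y - a ≠ 0 := sub_ne_zero.2 g4
  have f4' : a - y ≠ 0 := sub_ne_zero.2 g4.symm
  have f5 : 1 - x ≠ 0 := sub_ne_zero.2 hne.symm
  have f5' : x - 1 ≠ 0 := sub_ne_zero.2 hne
  have f6 : 1 - y ≠ 0 := sub_ne_zero.2 hne'.symm
  have f6' : y - 1 ≠ 0 := sub_ne_zero.2 hne'
  field_simp
  ring

/-- A sequence with quotients `ratio a ζ` on `[s, M - s]`, where `ζ ^ (2 * M + 1) = 1`, is
symmetric up to powers of `ζ`. -/
theorem eq_of_ratio {f : ℕ → K} {s M : ℕ} (ha : a ≠ 0) (h1 : ∀ i : ℕ, a * ζ ^ i ≠ 1)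
    (h2 : ∀ i : ℕ, ζ ^ i ≠ a) (hM : ζ ^ (2 * M + 1) = 1)
    (hf : ∀ t, s ≤ t → t + s < M → f (t + 1) = f t * ratio a ζ t)
    (hne : ∀ t, s ≤ t → t + s < M → ζ ^ (2 * t + 1) ≠ 1 ∧ ζ ^ (2 * t + 2) ≠ 1) :
    ∀ r j k, k = j + r → j + k = M → s ≤ j → f k = ζ ^ (4 * j + 1) * f j := by
  intro r
  induction r using Nat.strong_induction_on with
  -- The induction moves both ends inwards, so the gap `r` drops by two; the base cases are the
  -- centre `j = k` and the adjacent pair `k = j + 1`.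
  | _ r ih =>
    intro j k hr hjk hs
    rcases r with _ | _ | r
    · obtain rfl : k = j := by omega
      rw [show 4 * k + 1 = 2 * M + 1 by omega, hM, one_mul]
    · obtain rfl : k = j + 1 := by omega
      rw [hf j hs (by omega), ratio_of_mul_eq_one ha h1 h2
        (by rw [← hM]; congr 1; omega) (hne j hs (by omega)).2, mul_comm]
    · obtain ⟨k, rfl⟩ : ∃ k', k = k' + 1 := ⟨k - 1, by omega⟩
      have hd := hne j hs (by omega)
      have := ratio_mul_ratio (j := j) (k := k) ha h1 h2 (by rw [← hM]; congr 1; omega) hd.1 hd.2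
      rw [hf k (by omega) (by omega), ih r (by omega) (j + 1) k (by omega) (by omega) (by omega),
        hf j hs (by omega)]
      linear_combination ζ ^ (4 * j + 1) * f j * this

theorem qInt_mul_antisymm {f : ℕ → K} {s M : ℕ} (hζ1 : ζ ≠ 1) (ha : a ≠ 0)
    (h1 : ∀ i : ℕ, a * ζ ^ i ≠ 1) (h2 : ∀ i : ℕ, ζ ^ i ≠ a) (hM : ζ ^ (2 * M + 1) = 1)
    (hf : ∀ t, s ≤ t → t + s < M → f (t + 1) = f t * ratio a ζ t)
    (hne : ∀ t, s ≤ t → t + s < M → ζ ^ (2 * t + 1) ≠ 1 ∧ ζ ^ (2 * t + 2) ≠ 1)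
    {j k : ℕ} (hjk : j + k = M) (hj : s ≤ j) (hk : s ≤ k) :
    qInt ζ (4 * k + 1) * f k = -(qInt ζ (4 * j + 1) * f j) := by
  have hs : (1 : K) - ζ ≠ 0 := sub_ne_zero.2 hζ1.symm
  have key : ∀ j k, j ≤ k → j + k = M → s ≤ j →
      qInt ζ (4 * k + 1) * f k = -(qInt ζ (4 * j + 1) * f j) := by
    intro j k hle hjk hj
    rw [eq_of_ratio ha h1 h2 hM hf hne (k - j) j k (by omega) hjk hj, qInt_eq hζ1, qInt_eq hζ1]
    have : ζ ^ (4 * k + 1) * ζ ^ (4 * j + 1) = 1 := by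
      rw [← pow_add, show 4 * k + 1 + (4 * j + 1) = (2 * M + 1) * 2 by omega, pow_mul, hM, one_pow]
    field_simp
    linear_combination -f j * this
  rcases le_total j k with h | h
  · exact key j k h hjk hj
  · rw [key k j h (by omega) hk, neg_neg]

theorem c_antisymm {N j k : ℕ} (hN : 0 < N) (hζ : IsPrimitiveRoot ζ (2 * N + 1)) (ha : a ≠ 0)
    (h1 : ∀ i : ℕ, a * ζ ^ i ≠ 1) (h2 : ∀ i : ℕ, ζ ^ i ≠ a) (hjk : j + k = N) :
    c a ζ k = -c a ζ j := by
  rw [c_eq, c_eq]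
  refine qInt_mul_antisymm (s := 0) (hζ.ne_one (by omega)) ha h1 h2 hζ.pow_eq_one
    (fun t _ _ => b_succ a ζ t) (fun t _ ht => ⟨?_, ?_⟩) hjk (Nat.zero_le _) (Nat.zero_le _) <;>
  exact hζ.pow_ne_one_of_pos_of_lt (by omega) (by omega)

theorem c_eq_zero_of_isPrimitiveRoot {N u : ℕ} (hζ : ζ ^ (2 * N + 1) = 1) (hu : N < u) :
    c a ζ u = 0 := by
  have : qPoch ζ (ζ ^ 2) u = 0 :=
    Finset.prod_eq_zero (Finset.mem_range.2 hu) (by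
      rw [← pow_mul, ← pow_succ', hζ, sub_self])
  simp [c, this]

theorem sum_eq_zero_of_antisymm [CharZero K] {N : ℕ} {e : ℕ → K}
    (he : ∀ j k, j + k = N → e k = -e j) : ∑ u ∈ Finset.range (N + 1), e u = 0 := by
  refine self_eq_neg.1 ?_
  conv_lhs => rw [← Finset.sum_range_reflect]
  rw [← Finset.sum_neg_distrib]
  refine Finset.sum_congr rfl fun j hj => ?_
  rw [Finset.mem_range] at hj
  exact he _ _ (by omega)

/-- Reflecting `s ↦ N - 1 - s` changes the sign of `h`, while the partial sums of `e` of lengths `p`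
and `N + 1 - p` agree because the full sum is zero. The whole sum is therefore its own negative. -/
theorem sum_antisymm_mul_partial_sum [CharZero K] {N : ℕ} {e h : ℕ → K}
    (he : ∀ j k, j + k = N → e k = -e j)
    (hh : ∀ j k, N < j → N < k → j + k = 3 * N + 1 → h k = -h j) :
    ∑ s ∈ Finset.range N, h (N + 1 + s) * ∑ j ∈ Finset.range (N - s), e j = 0 := by
  have hsum : ∀ p p', p + p' = N + 1 →
      ∑ j ∈ Finset.range p, e j = ∑ j ∈ Finset.range p', e j := by
    intro p p' hp
    have e0 := sum_eq_zero_of_antisymm he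
    rw [← hp, Finset.sum_range_add, ← Finset.sum_range_reflect (fun x => e (p + x))] at e0
    rw [eq_neg_of_add_eq_zero_left e0, ← Finset.sum_neg_distrib]
    refine Finset.sum_congr rfl fun j hj => ?_
    rw [Finset.mem_range] at hj
    rw [he j (p + (p' - 1 - j)) (by omega), neg_neg]
  refine self_eq_neg.1 ?_
  conv_lhs => rw [← Finset.sum_range_reflect]
  rw [← Finset.sum_neg_distrib]
  refine Finset.sum_congr rfl fun s hs => ?_
  rw [Finset.mem_range] at hs
  rw [hh (N + 1 + s) _ (by omega) (by omega) (by omega),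
    hsum (N - (N - 1 - s)) (N - s) (by omega), neg_mul]

end RootOfUnity

/-! ### Reduction of fractions at the kernel of a specialization. -/

section Reduction

variable {R K κ : Type*} [CommRing R] [Field K] [Algebra R K] [Field κ] {φ : R →+* κ}

/-- The element `x` of the field of fractions of `R` is a fraction whose denominator is not in the
kernel of `φ : R →+* κ`, and `y` is its value under `φ`. -/
def Red (φ : R →+* κ) (x : K) (y : κ) : Prop :=
  ∃ N D : R, φ D ≠ 0 ∧ x * algebraMap R K D = algebraMap R K N ∧ y * φ D = φ N

theorem Red.algebraMap (φ : R →+* κ) (p : R) : Red φ (algebraMap R K p) (φ p) :=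
  ⟨p, 1, by simp, by simp, by simp⟩

theorem Red.zero : Red φ (0 : K) 0 := by simpa using Red.algebraMap (K := K) φ 0

theorem Red.one : Red φ (1 : K) 1 := by simpa using Red.algebraMap (K := K) φ 1

variable {x x' : K} {y y' : κ}

theorem Red.add (h : Red φ x y) (h' : Red φ x' y') : Red φ (x + x') (y + y') := by
  obtain ⟨N, D, hD, hx, hy⟩ := h
  obtain ⟨N', D', hD', hx', hy'⟩ := h'
  refine ⟨N * D' + N' * D, D * D', by simp [hD, hD'], ?_, ?_⟩
  · simp only [map_mul, map_add, ← hx, ← hx']; ring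
  · simp only [map_mul, map_add, ← hy, ← hy']; ring

theorem Red.mul (h : Red φ x y) (h' : Red φ x' y') : Red φ (x * x') (y * y') := by
  obtain ⟨N, D, hD, hx, hy⟩ := h
  obtain ⟨N', D', hD', hx', hy'⟩ := h'
  refine ⟨N * N', D * D', by simp [hD, hD'], ?_, ?_⟩
  · simp only [map_mul, ← hx, ← hx']; ring
  · simp only [map_mul, ← hy, ← hy']; ring

theorem Red.neg (h : Red φ x y) : Red φ (-x) (-y) := by
  obtain ⟨N, D, hD, hx, hy⟩ := h
  exact ⟨-N, D, hD, by simp [← hx], by simp [← hy]⟩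

theorem Red.sub (h : Red φ x y) (h' : Red φ x' y') : Red φ (x - x') (y - y') := by
  simpa only [sub_eq_add_neg] using h.add h'.neg

theorem Red.prod {ι : Type*} {s : Finset ι} {f : ι → K} {g : ι → κ}
    (h : ∀ i ∈ s, Red φ (f i) (g i)) : Red φ (∏ i ∈ s, f i) (∏ i ∈ s, g i) := by
  classical
  induction s using Finset.induction_on with
  | empty => simpa using Red.one
  | insert i s hi ih =>
    rw [Finset.prod_insert hi, Finset.prod_insert hi]
    exact (h i (Finset.mem_insert_self i s)).mul
      (ih fun j hj => h j (Finset.mem_insert_of_mem hj))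

theorem Red.sum {ι : Type*} {s : Finset ι} {f : ι → K} {g : ι → κ}
    (h : ∀ i ∈ s, Red φ (f i) (g i)) : Red φ (∑ i ∈ s, f i) (∑ i ∈ s, g i) := by
  classical
  induction s using Finset.induction_on with
  | empty => simpa using Red.zero
  | insert i s hi ih =>
    rw [Finset.sum_insert hi, Finset.sum_insert hi]
    exact (h i (Finset.mem_insert_self i s)).add
      (ih fun j hj => h j (Finset.mem_insert_of_mem hj))

theorem Red.pow (h : Red φ x y) (n : ℕ) : Red φ (x ^ n) (y ^ n) := by
  simpa using Red.prod (s := Finset.range n) fun _ _ => h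

theorem Red.qInt (h : Red φ x y) (n : ℕ) : Red φ (qInt x n) (qInt y n) :=
  Red.sum fun i _ => h.pow i

theorem Red.one_sub (h : Red φ x y) : Red φ (1 - x) (1 - y) := Red.one.sub h

variable {a q : K} {a' ζ : κ}

section

variable [IsFractionRing R K]

theorem Red.inv (h : Red φ x y) (hy0 : y ≠ 0) : Red φ x⁻¹ y⁻¹ := by
  obtain ⟨N, D, hD, hx, hy⟩ := h
  have hN : φ N ≠ 0 := hy ▸ mul_ne_zero hy0 hD
  have hx0 : x ≠ 0 := by
    rintro rfl
    rw [zero_mul, eq_comm, map_eq_zero_iff _ (IsFractionRing.injective R K)] at hx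
    exact hN (by simp [hx])
  exact ⟨D, N, hN, by rw [← hx, inv_mul_cancel_left₀ hx0], by rw [← hy, inv_mul_cancel_left₀ hy0]⟩

theorem Red.div (h : Red φ x y) (h' : Red φ x' y') (hy : y' ≠ 0) : Red φ (x / x') (y / y') := by
  simpa only [div_eq_mul_inv] using h.mul (h'.inv hy)

/-- The part of `ratio` that contains `a`. -/
def ratioA {K : Type*} [Field K] (a q : K) (t : ℕ) : K :=
  -q ^ (2 * t + 1) * ((1 - a * q ^ (2 * t + 1)) * (1 - q ^ (2 * t + 1) / a) /
    ((1 - a * q ^ (2 * t + 2)) * (1 - q ^ (2 * t + 2) / a)))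

theorem ratio_eq {K : Type*} [Field K] (a q : K) (t : ℕ) :
    ratio a q t = ratioA a q t * ((1 - q ^ (2 * t + 1)) / (1 - q ^ (2 * t + 2))) := by
  rw [ratio, ratioA, mul_assoc (-q ^ (2 * t + 1)), div_mul_div_comm]

theorem Red.ratioA (hqr : Red φ q ζ) (har : Red φ a a') (ha : a' ≠ 0) {t : ℕ}
    (h1 : a' * ζ ^ (2 * t + 2) ≠ 1) (h2 : ζ ^ (2 * t + 2) ≠ a') :
    Red φ (ratioA a q t) (ratioA a' ζ t) := by
  have hr := hqr.pow (2 * t + 1)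
  have hr' := hqr.pow (2 * t + 2)
  refine hr.neg.mul (((har.mul hr).one_sub.mul (hr.div har ha).one_sub).div
    ((har.mul hr').one_sub.mul (hr'.div har ha).one_sub) (mul_ne_zero (sub_ne_zero.2 h1.symm)
      (sub_ne_zero.2 fun h => h2 ?_)))
  rw [eq_div_iff ha, one_mul] at h
  exact h.symm

theorem Red.ratio (hqr : Red φ q ζ) (har : Red φ a a') (ha : a' ≠ 0) {t : ℕ}
    (h1 : a' * ζ ^ (2 * t + 2) ≠ 1) (h2 : ζ ^ (2 * t + 2) ≠ a') (h3 : ζ ^ (2 * t + 2) ≠ 1) :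
    Red φ (ratio a q t) (ratio a' ζ t) := by
  rw [ratio_eq, ratio_eq]
  exact (hqr.ratioA har ha h1 h2).mul ((hqr.pow _).one_sub.div (hqr.pow _).one_sub
    (sub_ne_zero.2 h3.symm))

theorem Red.c (hqr : Red φ q ζ) (har : Red φ a a') (ha : a' ≠ 0) {k : ℕ}
    (h1 : ∀ t < k, a' * ζ ^ (2 * t + 2) ≠ 1) (h2 : ∀ t < k, ζ ^ (2 * t + 2) ≠ a')
    (h3 : ∀ t < k, ζ ^ (2 * t + 2) ≠ 1) : Red φ (c a q k) (c a' ζ k) := by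
  rw [c_eq, c_eq]
  refine (hqr.qInt _).mul (Red.prod fun t ht => ?_)
  rw [Finset.mem_range] at ht
  exact hqr.ratio har ha (h1 t ht) (h2 t ht) (h3 t ht)

end

/-- Among the denominator factors `1 - q^(2t+2)` of a block, only that of the last index can reduce
to zero. -/
theorem not_dvd_two_mul_add_two {N l t : ℕ} (ht : t < 2 * N) :
    ¬ 2 * N + 1 ∣ 2 * ((2 * N + 1) * l + t) + 2 := by
  intro hd
  have h2 : 2 * N + 1 ∣ 2 * (t + 1) := by
    rw [show 2 * ((2 * N + 1) * l + t) + 2 = (2 * N + 1) * (2 * l) + 2 * (t + 1) by ring] at hd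
    exact (Nat.dvd_add_right (Dvd.intro _ rfl)).1 hd
  have h3 : Nat.Coprime (2 * N + 1) 2 := by simp
  have := Nat.le_of_dvd (by omega) (h3.dvd_of_dvd_mul_left h2)
  omega

/-- Reduction of `q` to a primitive root of unity `ζ` of odd order, and of `a` to an element of `κ`
that differs from `0` and from the powers of `ζ`. -/
structure RootRed (φ : R →+* κ) (a q : K) (a' ζ : κ) (N : ℕ) : Prop where
  pos : 0 < N
  red_q : Red φ q ζ
  red_a : Red φ a a'
  pow_ne : q ^ (2 * N + 1) ≠ 1
  ne_zero : a' ≠ 0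
  mul_ne : ∀ i : ℕ, a' * ζ ^ i ≠ 1
  ne : ∀ i : ℕ, ζ ^ i ≠ a'
  prim : IsPrimitiveRoot ζ (2 * N + 1)

namespace RootRed

variable {N : ℕ} (h : RootRed φ a q a' ζ N)
include h

theorem one_sub_ne {i : ℕ} (hi : ¬ 2 * N + 1 ∣ i) : 1 - ζ ^ i ≠ 0 :=
  sub_ne_zero.2 fun h' => hi (h.prim.dvd_of_pow_eq_one _ h'.symm)

theorem ratio_add (l t : ℕ) : ratio a' ζ ((2 * N + 1) * l + t) = ratio a' ζ t := by
  have : ∀ i, ζ ^ (2 * ((2 * N + 1) * l + t) + i) = ζ ^ (2 * t + i) := fun i => by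
    rw [show 2 * ((2 * N + 1) * l + t) + i = (2 * N + 1) * (2 * l) + (2 * t + i) by ring, pow_add,
      pow_mul, h.prim.pow_eq_one, one_pow, one_mul]
  rw [ratio, ratio, this, this]

theorem ne_one : ζ ≠ 1 := h.prim.ne_one (by have := h.pos; omega)

variable [IsFractionRing R K]

theorem red_prod_ratio {s m : ℕ} (hs : ∀ t < m, ¬ 2 * N + 1 ∣ 2 * (s + t) + 2) :
    Red φ (∏ t ∈ Finset.range m, ratio a q (s + t)) (∏ t ∈ Finset.range m, ratio a' ζ (s + t)) := by
  refine Red.prod fun t ht => h.red_q.ratio h.red_a h.ne_zero (h.mul_ne _) (h.ne _) fun h' => ?_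
  exact hs t (Finset.mem_range.1 ht) (h.prim.dvd_of_pow_eq_one _ h')

theorem red_ratioA (t : ℕ) : Red φ (ratioA a q t) (ratioA a' ζ t) :=
  h.red_q.ratioA h.red_a h.ne_zero (h.mul_ne _) (h.ne _)

/-- Cancelling `1 - q^(2N+1)` leaves a quotient of `q^(2N+1)`-integers whose denominator reduces to
`l + 1`, nonzero in characteristic zero. -/
theorem exists_red_one_sub_div [CharZero κ] (m l : ℕ) :
    ∃ y, Red φ ((1 - q ^ ((2 * N + 1) * m)) / (1 - q ^ ((2 * N + 1) * (l + 1)))) y := by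
  have hr : Red φ (q ^ (2 * N + 1)) 1 := by
    simpa [h.prim.pow_eq_one] using h.red_q.pow (2 * N + 1)
  have hne : (1 : K) - q ^ (2 * N + 1) ≠ 0 := sub_ne_zero.2 h.pow_ne.symm
  have hq : ∀ k, 1 - q ^ ((2 * N + 1) * k) = (1 - q ^ (2 * N + 1)) * qInt (q ^ (2 * N + 1)) k :=
    fun k => by rw [pow_mul]; exact (mul_neg_geom_sum _ _).symm
  rw [hq, hq, mul_div_mul_left _ _ hne]
  refine ⟨_, (hr.qInt m).div (hr.qInt (l + 1)) ?_⟩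
  simp only [qInt, one_pow, Finset.sum_const, Finset.card_range, nsmul_eq_mul, mul_one]
  exact Nat.cast_ne_zero.2 (Nat.succ_ne_zero l)

theorem exists_red_b [CharZero κ] (l : ℕ) : ∃ y, Red φ (b a q ((2 * N + 1) * l)) y := by
  induction l with
  | zero => exact ⟨1, by simpa [b] using Red.one⟩
  | succ l ih =>
    obtain ⟨γ, hγ⟩ := ih
    -- Within a block, the vanishing numerator factor occurs at offset `N` and the vanishing
    -- denominator factor at offset `2N`, with exponents `(2N+1)(2l+1)` and `(2N+1)(2l+2)`; they
    -- must be reduced together.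
    obtain ⟨δ, hδ⟩ := h.exists_red_one_sub_div (2 * l + 1) (2 * l + 1)
    have hN := h.pos
    set s := (2 * N + 1) * l with hs
    have e1 := h.red_prod_ratio (s := s) (m := N) fun t ht => not_dvd_two_mul_add_two (by omega)
    have e2 := h.red_prod_ratio (s := s + (N + 1)) (m := N - 1) fun t ht => by
      rw [add_assoc]; exact not_dvd_two_mul_add_two (by omega)
    have e3 := (h.red_ratioA (s + N)).div (h.red_q.pow (2 * (s + N) + 2)).one_sub
      (h.one_sub_ne (not_dvd_two_mul_add_two (by omega)))
    have e4 := (h.red_ratioA (s + 2 * N)).mul (h.red_q.pow (2 * (s + 2 * N) + 1)).one_sub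
    refine ⟨_, (congrArg (Red φ · _) ?_).mpr (((((hγ.mul e1).mul e3).mul e2).mul e4).mul hδ)⟩
    have : b a q ((2 * N + 1) * (l + 1)) = b a q s * (∏ t ∈ Finset.range N, ratio a q (s + t)) *
        ratio a q (s + N) * (∏ t ∈ Finset.range (N - 1), ratio a q (s + (N + 1) + t)) *
        ratio a q (s + 2 * N) := by
      rw [show (2 * N + 1) * (l + 1) = s + N + 1 + (N - 1) + 1 by rw [hs, mul_add]; omega,
        b_succ, show s + N + 1 + (N - 1) = s + 2 * N by omega]
      congr 1
      rw [show s + 2 * N = s + (N + 1) + (N - 1) by omega, b, Finset.prod_range_add]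
      congr 1
      rw [← add_assoc, Finset.prod_range_succ, Finset.prod_range_add, b]
    rw [this, ratio_eq a q (s + N), ratio_eq a q (s + 2 * N),
      show (2 * N + 1) * (2 * l + 1) = 2 * (s + N) + 1 by rw [hs]; ring,
      show (2 * N + 1) * (2 * l + 1 + 1) = 2 * (s + 2 * N) + 2 by rw [hs]; ring]
    simp only [div_eq_mul_inv]
    ring

theorem exists_red_c [CharZero κ] :
    ∃ γ : ℕ → κ, ∀ i, Red φ (c a q i) (γ (i / (2 * N + 1)) * c a' ζ (i % (2 * N + 1))) := by
  choose γ hγ using h.exists_red_b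
  have key : ∀ l u, u < 2 * N + 1 → Red φ (c a q ((2 * N + 1) * l + u)) (γ l * c a' ζ u) := by
    intro l u hu
    have e := h.red_prod_ratio (s := (2 * N + 1) * l) (m := u) fun t ht =>
      not_dvd_two_mul_add_two (by omega)
    simp only [h.ratio_add] at e
    have hI : qInt ζ (4 * ((2 * N + 1) * l + u) + 1) = qInt ζ (4 * u + 1) := by
      rw [qInt_eq h.ne_one, qInt_eq h.ne_one, show 4 * ((2 * N + 1) * l + u) + 1 =
        (2 * N + 1) * (4 * l) + (4 * u + 1) by ring, pow_add, pow_mul, h.prim.pow_eq_one, one_pow,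
        one_mul]
    rw [c_eq, c_eq, b, Finset.prod_range_add]
    convert (h.red_q.qInt (4 * ((2 * N + 1) * l + u) + 1)).mul ((hγ l).mul e) using 1
    · rfl
    · rw [hI, b]
      ring
  refine ⟨γ, fun i => ?_⟩
  have := key (i / (2 * N + 1)) (i % (2 * N + 1)) (Nat.mod_lt _ (by omega))
  rwa [Nat.div_add_mod] at this

/-- The double sum is divisible by `Φ_d(q)`. -/
theorem red_convolution [CharZero κ] (m : ℕ) :
    Red φ (∑ i ∈ Finset.range ((2 * N + 1) * m), ∑ j ∈ Finset.range ((2 * N + 1) * m - i),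
      c a q i * c a q j) 0 := by
  obtain ⟨γ, hγ⟩ := h.exists_red_c
  rw [← convolution_sum_blocks (γ := γ) (e := c a' ζ) (N := N) (m := m)
    (fun u hu _ => c_eq_zero_of_isPrimitiveRoot h.prim.pow_eq_one hu)
    (sum_eq_zero_of_antisymm fun j k => c_antisymm h.pos h.prim h.ne_zero h.mul_ne h.ne)]
  exact Red.sum fun i _ => Red.sum fun j _ => (hγ i).mul (hγ j)

theorem red_b {k : ℕ} (hk : k < 2 * N + 1) : Red φ (b a q k) (b a' ζ k) := by
  have := h.red_prod_ratio (s := (2 * N + 1) * 0) (m := k) fun t ht =>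
    not_dvd_two_mul_add_two (by omega)
  simp only [mul_zero, zero_add] at this
  exact this

theorem red_c {k : ℕ} (hk : k < 2 * N + 1) : Red φ (c a q k) (c a' ζ k) := by
  rw [c_eq, c_eq]
  exact (h.red_q.qInt _).mul (h.red_b hk)

/-- For `n = 2N+1`, the double sum is the sum of a square of a multiple of `Φ_n(q)` and of a product
of `1 - q ^ n` and a multiple of `Φ_n(q)`. -/
theorem exists_convolution_eq [CharZero κ] :
    ∃ S Y : K, Red φ S 0 ∧ Red φ Y 0 ∧
      ∑ i ∈ Finset.range (2 * N + 1), ∑ j ∈ Finset.range (2 * N + 1 - i), c a q i * c a q j =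
        S ^ 2 + 2 * ((1 - q ^ (2 * N + 1)) * Y) := by
  have hN := h.pos
  have hanti : ∀ j k, j + k = N → c a' ζ k = -c a' ζ j := fun j k =>
    c_antisymm h.pos h.prim h.ne_zero h.mul_ne h.ne
  have e1 : Red φ (b a q N) (b a' ζ N) := h.red_b (by omega)
  have hnd : ∀ t < 2 * N, ¬ 2 * N + 1 ∣ 2 * t + 2 := fun t ht => by
    simpa using not_dvd_two_mul_add_two (l := 0) ht
  have e2 := (h.red_ratioA N).div (h.red_q.pow (2 * N + 2)).one_sub
    (h.one_sub_ne (hnd N (by omega)))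
  -- `g s` is the term of index `N + 1 + s` without the factor `1 - q^(2N+1)`, which comes from the
  -- ratio at `N`; `f` is its reduction without the `q`-integer.
  set g : ℕ → K := fun s => qInt q (4 * (N + 1 + s) + 1) * (b a q N *
    (ratioA a q N / (1 - q ^ (2 * N + 2))) * ∏ t ∈ Finset.range s, ratio a q (N + 1 + t)) with hg
  set f : ℕ → κ := fun i => b a' ζ N * (ratioA a' ζ N / (1 - ζ ^ (2 * N + 2))) *
    ∏ t ∈ Finset.range (i - (N + 1)), ratio a' ζ (N + 1 + t) with hf
  have hgf : ∀ s < N, Red φ (g s) (qInt ζ (4 * (N + 1 + s) + 1) * f (N + 1 + s)) := by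
    intro s hs
    simp only [hf, Nat.add_sub_cancel_left]
    refine (h.red_q.qInt _).mul ((e1.mul e2).mul (h.red_prod_ratio fun t ht => hnd _ (by omega)))
  refine ⟨∑ i ∈ Finset.range (N + 1), c a q i,
    ∑ s ∈ Finset.range N, g s * ∑ j ∈ Finset.range (N - s), c a q j, ?_, ?_, ?_⟩
  · rw [← sum_eq_zero_of_antisymm hanti]
    refine Red.sum fun i hi => h.red_c ?_
    rw [Finset.mem_range] at hi
    omega
  · rw [← sum_antisymm_mul_partial_sum (N := N) (e := c a' ζ)
      (h := fun i => qInt ζ (4 * i + 1) * f i) hanti]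
    · refine Red.sum fun s hs => (hgf s (Finset.mem_range.1 hs)).mul (Red.sum fun j hj => h.red_c ?_)
      rw [Finset.mem_range] at hj
      omega
    · intro j k hj hk hjk
      -- The centre is shifted to `M = 3N + 1`, for which `2M + 1 = 3(2N + 1)` still kills the power
      -- of `ζ`.
      refine qInt_mul_antisymm (s := N + 1) h.ne_one h.ne_zero h.mul_ne h.ne (M := 3 * N + 1) ?_
        ?_ ?_ hjk hj hk
      · rw [show 2 * (3 * N + 1) + 1 = (2 * N + 1) * 3 by ring, pow_mul, h.prim.pow_eq_one, one_pow]
      · intro t ht _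
        obtain ⟨t, rfl⟩ := Nat.exists_eq_add_of_le ht
        simp only [hf, Nat.add_sub_cancel_left, show N + 1 + t + 1 - (N + 1) = t + 1 by omega,
          Finset.prod_range_succ]
        ring
      · intro t ht ht'
        refine ⟨fun h' => ?_, fun h' => hnd t (by omega) (h.prim.dvd_of_pow_eq_one _ h')⟩
        obtain ⟨w, hw⟩ := h.prim.dvd_of_pow_eq_one _ h'
        have h3 : w < 2 := by
          by_contra hcon
          have := Nat.mul_le_mul_left (2 * N + 1) (not_lt.1 hcon)
          omega
        interval_cases w <;> omega
  · rw [convolution_sum_eq, Finset.mul_sum (Finset.range N) _ (1 - q ^ (2 * N + 1))]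
    congr 2
    refine Finset.sum_congr rfl fun s _ => ?_
    rw [c_eq, b, Finset.prod_range_add, Finset.prod_range_succ, ratio_eq a q N, ← b]
    simp only [hg, div_eq_mul_inv]
    ring

end RootRed

end Reduction

/-! ### Divisibility in the local ring at a kernel. -/

section Divisibility

variable {R K κ : Type*} [CommRing R] [Field K] [Algebra R K] [Field κ] {φ : R →+* κ}

/-- The element `x` of the field of fractions of `R` is a multiple of `P` by a fraction whose
denominator is not in the kernel of `φ`. -/
def DivBy (φ : R →+* κ) (P : R) (x : K) : Prop :=
  ∃ N D : R, φ D ≠ 0 ∧ x * algebraMap R K D = algebraMap R K (P * N)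

variable {P Q : R} {x y : K}

theorem Red.divBy (h : Red φ x 0) (hφ : ∀ p, φ p = 0 → P ∣ p) : DivBy φ P x := by
  obtain ⟨N, D, hD, hx, hy⟩ := h
  obtain ⟨M, rfl⟩ := hφ N (by rw [← hy, zero_mul])
  exact ⟨M, D, hD, hx⟩

theorem DivBy.add (h : DivBy φ P x) (h' : DivBy φ P y) : DivBy φ P (x + y) := by
  obtain ⟨N, D, hD, hx⟩ := h
  obtain ⟨N', D', hD', hx'⟩ := h'
  refine ⟨N * D' + N' * D, D * D', by simp [hD, hD'], ?_⟩
  simp only [map_mul, map_add] at *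
  linear_combination algebraMap R K D' * hx + algebraMap R K D * hx'

/-- Reduction to zero only detects a single factor `P`; multiplying two such statements reaches
`P^2`. -/
theorem DivBy.mul (h : DivBy φ P x) (h' : DivBy φ Q y) : DivBy φ (P * Q) (x * y) := by
  obtain ⟨N, D, hD, hx⟩ := h
  obtain ⟨N', D', hD', hx'⟩ := h'
  refine ⟨N * N', D * D', by simp [hD, hD'], ?_⟩
  simp only [map_mul] at *
  linear_combination (y * algebraMap R K D') * hx +
    algebraMap R K P * algebraMap R K N * hx'

theorem DivBy.mul_algebraMap (h : DivBy φ P x) (p : R) :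
    DivBy φ P (x * algebraMap R K p) := by
  obtain ⟨N, D, hD, hx⟩ := h
  refine ⟨N * p, D, hD, ?_⟩
  simp only [map_mul] at *
  linear_combination algebraMap R K p * hx

theorem prime_of_ker (hP : P ≠ 0) (hφP : φ P = 0) (hφ : ∀ p, φ p = 0 → P ∣ p) : Prime P := by
  refine ⟨hP, fun hu => (hu.map φ).ne_zero hφP, fun x y hxy => ?_⟩
  obtain ⟨z, hz⟩ := hxy
  have : φ x * φ y = 0 := by rw [← map_mul, hz, map_mul, hφP, zero_mul]
  exact (mul_eq_zero.1 this).imp (hφ x) (hφ y)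

theorem isRelPrime_of_ker [IsDomain R] (hP : P ≠ 0) (hφP : φ P = 0) (hφ : ∀ p, φ p = 0 → P ∣ p)
    {D : R} (hD : φ D ≠ 0) : IsRelPrime P D := by
  refine (prime_of_ker hP hφP hφ).irreducible.isRelPrime_iff_not_dvd.2 ?_
  rintro ⟨z, rfl⟩
  exact hD (by rw [map_mul, hφP, zero_mul])

end Divisibility

/-! ### From specializations to congruences. -/

section Congruences

theorem DivBy.congr {κ : Type*} [Field κ] {φ : Poly →+* κ} {P : Poly} {e : ℕ} {A B : Rat2}
    (h : DivBy φ (P ^ e) (A - B)) (hP : P ≠ 0) (hφP : φ P = 0) (hφ : ∀ p, φ p = 0 → P ∣ p) :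
    Congr (P ^ e) A B := by
  obtain ⟨N, D, hD, hx⟩ := h
  have hD0 : D ≠ 0 := fun h0 => hD (by rw [h0, map_zero])
  refine ⟨N, D, hD0, (isRelPrime_of_ker hP hφP hφ hD).symm.pow_right, ?_⟩
  rw [← hx, mul_div_cancel_right₀]
  exact (map_ne_zero_iff _ (IsFractionRing.injective Poly Rat2)).2 hD0

/-- Passing to the reduced fraction removes the choice of denominator, so congruences for coprime
moduli can be combined. -/
theorem congr_iff {P : Poly} {A B : Rat2} :
    Congr P A B ↔ P ∣ IsFractionRing.num Poly (A - B) ∧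
      IsRelPrime (IsFractionRing.den Poly (A - B) : Poly) P := by
  have inj := IsFractionRing.injective Poly Rat2
  have hred := IsFractionRing.num_den_reduced Poly (A - B)
  have hx := IsFractionRing.mk'_num_den' Poly (A - B)
  set n := IsFractionRing.num Poly (A - B)
  have hd0 : (IsFractionRing.den Poly (A - B) : Poly) ≠ 0 :=
    nonZeroDivisors.coe_ne_zero _
  set d : Poly := (IsFractionRing.den Poly (A - B) : Poly)
  have hd0' := (map_ne_zero_iff (algebraMap Poly Rat2) inj).2 hd0
  constructor
  · rintro ⟨N, D, hD0, hD, h⟩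
    have hD0' := (map_ne_zero_iff (algebraMap Poly Rat2) inj).2 hD0
    have key : n * D = P * N * d := by
      apply inj
      rw [map_mul, map_mul]
      rw [h, div_eq_div_iff hd0' hD0'] at hx
      exact hx
    refine ⟨hD.symm.dvd_of_dvd_mul_right ⟨N * d, by rw [key, mul_assoc]⟩, hD.of_dvd_left ?_⟩
    exact hred.symm.dvd_of_dvd_mul_left ⟨P * N, by rw [key, mul_comm]⟩
  · rintro ⟨⟨N, hN⟩, hd⟩
    exact ⟨N, d, hd0, hd, by rw [← hN, hx]⟩

theorem Congr.mul {P Q : Poly} {A B : Rat2} (h : Congr P A B) (h' : Congr Q A B)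
    (hPQ : IsRelPrime P Q) : Congr (P * Q) A B := by
  rw [congr_iff] at *
  exact ⟨hPQ.mul_dvd h.1 h'.1, h.2.mul_right h'.2⟩

theorem Congr.prod {ι : Type*} {s : Finset ι} {P : ι → Poly} {A B : Rat2}
    (h : ∀ i ∈ s, Congr (P i) A B) (hs : (s : Set ι).Pairwise fun i j => IsRelPrime (P i) (P j)) :
    Congr (∏ i ∈ s, P i) A B := by
  classical
  induction s using Finset.induction_on with
  | empty => exact congr_iff.2 (by simp [isRelPrime_one_right])
  | insert i s hi ih =>
    rw [Finset.prod_insert hi]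
    refine (h i (Finset.mem_insert_self i s)).mul
      (ih (fun j hj => h j (Finset.mem_insert_of_mem hj))
        (hs.mono (Finset.coe_subset.2 (Finset.subset_insert i s)))) (IsRelPrime.prod_right ?_)
    intro j hj
    exact hs (Finset.mem_coe.2 (Finset.mem_insert_self i s))
      (Finset.mem_coe.2 (Finset.mem_insert_of_mem hj)) (by rintro rfl; exact hi hj)

theorem qF_pow_ne_one {m : ℕ} (hm : 0 < m) : qF ^ m ≠ 1 := by
  intro h
  rw [qF, ← map_pow, ← map_one (algebraMap Poly Rat2)] at h
  have h2 := congrArg (fun p : Poly => (p.eval 0).eval 0) (IsFractionRing.injective Poly Rat2 h)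
  simp [qP, hm.ne'] at h2

section Cyclotomic

/-- The substitution of a complex number `ζ` for `q`. -/
def substQ (ζ : ℂ) : Poly →+* FractionRing ℂ[X] :=
  (algebraMap ℂ[X] (FractionRing ℂ[X])).comp (mapRingHom (aeval (R := ℤ) ζ).toRingHom)

theorem substQ_C (ζ : ℂ) (p : ℤ[X]) :
    substQ ζ (C p) = algebraMap ℂ[X] (FractionRing ℂ[X]) (C (aeval ζ p)) := by
  simp [substQ]

theorem substQ_aP (ζ : ℂ) : substQ ζ aP = algebraMap ℂ[X] (FractionRing ℂ[X]) X := by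
  simp [substQ, aP]

theorem substQ_qP (ζ : ℂ) : substQ ζ qP = algebraMap ℂ[X] (FractionRing ℂ[X]) (C ζ) := by
  simp [qP, substQ_C]

variable {ζ : ℂ} {d : ℕ}

/-- `Φ_d` is the minimal polynomial of `ζ` over `ℤ`, so it divides every coefficient in `a`. -/
theorem C_cyclotomic_dvd (hζ : IsPrimitiveRoot ζ d) (hd : 0 < d) (p : Poly)
    (hp : substQ ζ p = 0) : C (cyclotomic d ℤ) ∣ p := by
  rw [substQ, RingHom.comp_apply,
    map_eq_zero_iff _ (IsFractionRing.injective ℂ[X] (FractionRing ℂ[X]))] at hp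
  rw [C_dvd_iff_dvd_coeff]
  intro i
  rw [cyclotomic_eq_minpoly hζ hd]
  refine minpoly.isIntegrallyClosed_dvd (hζ.isIntegral hd) ?_
  simpa using congrArg (fun r : ℂ[X] => r.coeff i) hp

theorem substQ_C_cyclotomic_eq_zero_iff {e : ℕ} [NeZero (e : ℂ)] :
    substQ ζ (C (cyclotomic e ℤ)) = 0 ↔ IsPrimitiveRoot ζ e := by
  rw [substQ_C, map_eq_zero_iff _ (IsFractionRing.injective ℂ[X] (FractionRing ℂ[X])), C_eq_zero,
    ← isRoot_cyclotomic_iff, IsRoot.def, aeval_def, eval₂_eq_eval_map, algebraMap_int_eq,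
    map_cyclotomic]

theorem algebraMap_ne_zero_of_eval {p : ℂ[X]} (hp : p.eval 0 ≠ 0) :
    algebraMap ℂ[X] (FractionRing ℂ[X]) p ≠ 0 := by
  rw [Ne, map_eq_zero_iff _ (IsFractionRing.injective ℂ[X] (FractionRing ℂ[X]))]
  rintro rfl
  simp at hp

theorem rootRed {N : ℕ} (hN : 0 < N) (hζ : IsPrimitiveRoot ζ (2 * N + 1)) :
    RootRed (substQ ζ) aF qF (algebraMap ℂ[X] (FractionRing ℂ[X]) X)
      (algebraMap ℂ[X] (FractionRing ℂ[X]) (C ζ)) N where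
  pos := hN
  red_q := by
    rw [← substQ_qP]
    exact Red.algebraMap _ _
  red_a := by
    rw [← substQ_aP]
    exact Red.algebraMap _ _
  pow_ne := qF_pow_ne_one (by omega)
  ne_zero := by
    rw [Ne, map_eq_zero_iff _ (IsFractionRing.injective ℂ[X] (FractionRing ℂ[X]))]
    exact X_ne_zero
  mul_ne i h := by
    rw [← map_pow, ← map_mul, ← map_one (algebraMap ℂ[X] (FractionRing ℂ[X]))] at h
    simpa using congrArg (eval 0) (IsFractionRing.injective ℂ[X] (FractionRing ℂ[X]) h)
  ne i h := by
    rw [← map_pow] at h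
    have := congrArg (eval 0) (IsFractionRing.injective ℂ[X] (FractionRing ℂ[X]) h)
    simp only [eval_pow, eval_C, eval_X] at this
    exact pow_ne_zero i (hζ.ne_zero (by omega)) this
  prim := by
    have hinj : Function.Injective ((algebraMap ℂ[X] (FractionRing ℂ[X])).comp C) :=
      RingHom.injective _
    exact hζ.map_of_injective hinj

end Cyclotomic

section Linear

theorem red_convolution_sub_of_pow {R K κ : Type*} [CommRing R] [Field K] [Algebra R K]
    [IsFractionRing R K] [Field κ] {φ : R →+* κ} {a q : K} {a' z : κ} (hq : Red φ q z)
    (ha : Red φ a a') (hz : z ≠ 0) (hz1 : ∀ m : ℕ, 0 < m → z ^ m ≠ 1) {N : ℕ}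
    (ha' : a' = z ^ (2 * N + 1) ∨ a' = (z ^ (2 * N + 1))⁻¹) :
    Red φ (∑ i ∈ Finset.range (2 * N + 1), ∑ j ∈ Finset.range (2 * N + 1 - i),
      c a q i * c a q j - q ^ (2 * N ^ 2) * qInt q (2 * N + 1) ^ 2) 0 := by
  have hc : ∀ k, c a' z k = c (z ^ (2 * N + 1)) z k := by
    rcases ha' with rfl | rfl
    · exact fun _ => rfl
    · exact c_inv _ _
  have hne : ∀ i j : ℕ, i < j → z ^ j ≠ z ^ i := fun i j hij h => hz1 (j - i) (by omega) (by
    obtain ⟨k, rfl⟩ := Nat.exists_eq_add_of_lt hij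
    rw [show i + k + 1 - i = k + 1 by omega]
    rw [add_assoc, pow_add] at h
    exact mul_left_cancel₀ (pow_ne_zero i hz) (by rw [h, mul_one]))
  -- The parity of the exponents keeps the denominators nonzero under the specialization.
  have hne' : ∀ t : ℕ, z ^ (2 * t + 2) ≠ z ^ (2 * N + 1) := fun t => by
    rcases lt_or_gt_of_ne (by omega : 2 * t + 2 ≠ 2 * N + 1) with h | h
    · exact (hne _ _ h).symm
    · exact hne _ _ h
  have hmul : ∀ t : ℕ, z ^ (2 * N + 1) * z ^ (2 * t + 2) ≠ 1 := fun t => by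
    rw [← pow_add]
    exact hz1 _ (by omega)
  have hz' := pow_ne_zero (2 * N + 1) hz
  have hred : ∀ k, Red φ (c a q k) (c (z ^ (2 * N + 1)) z k) := by
    intro k
    rw [← hc]
    refine hq.c ha ?_ ?_ ?_ fun t _ => hz1 _ (by omega)
    · rcases ha' with rfl | rfl
      · exact hz'
      · exact inv_ne_zero hz'
    · intro t _
      rcases ha' with rfl | rfl
      · exact hmul t
      · rw [Ne, inv_mul_eq_one₀ hz']
        exact (hne' t).symm
    · intro t _
      rcases ha' with rfl | rfl
      · exact hne' t
      · exact fun h => hmul t (by rw [h, mul_inv_cancel₀ hz'])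
  have := (Red.sum (s := Finset.range (2 * N + 1)) fun i _ =>
    Red.sum (s := Finset.range (2 * N + 1 - i)) fun j _ => (hred i).mul (hred j)).sub
    ((hq.pow (2 * N ^ 2)).mul ((hq.qInt (2 * N + 1)).pow 2))
  rwa [convolution_sum_c_pow hz hz1, sub_self] at this

/-- The substitution of `x` for `a`. -/
def substA (x : FractionRing ℤ[X]) : Poly →+* FractionRing ℤ[X] :=
  eval₂RingHom (algebraMap ℤ[X] (FractionRing ℤ[X])) x

theorem substA_aP (x : FractionRing ℤ[X]) : substA x aP = x := by
  simp [substA, aP]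

theorem substA_qP (x : FractionRing ℤ[X]) :
    substA x qP = algebraMap ℤ[X] (FractionRing ℤ[X]) X := by
  simp [substA, qP]

theorem algebraMap_X_ne_zero : algebraMap ℤ[X] (FractionRing ℤ[X]) X ≠ 0 :=
  (map_ne_zero_iff _ (IsFractionRing.injective _ _)).2 X_ne_zero

theorem algebraMap_X_pow_ne_one (m : ℕ) (hm : 0 < m) :
    algebraMap ℤ[X] (FractionRing ℤ[X]) X ^ m ≠ 1 := by
  intro h
  rw [← map_pow, ← map_one (algebraMap ℤ[X] (FractionRing ℤ[X]))] at h
  have := congrArg (eval 0) (IsFractionRing.injective ℤ[X] (FractionRing ℤ[X]) h)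
  simp [hm.ne'] at this

theorem aP_sub_dvd (n : ℕ) (p : Poly)
    (hp : substA (algebraMap ℤ[X] (FractionRing ℤ[X]) X ^ n) p = 0) : aP - qP ^ n ∣ p := by
  have : substA (algebraMap ℤ[X] (FractionRing ℤ[X]) X ^ n) p =
      algebraMap ℤ[X] (FractionRing ℤ[X]) (p.eval (X ^ n)) := by
    rw [substA, coe_eval₂RingHom, ← map_pow, eval₂_at_apply]
  rw [this, map_eq_zero_iff _ (IsFractionRing.injective _ _)] at hp
  rw [aP, qP, ← C_pow, dvd_iff_isRoot]
  exact hp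

/-- The divisor is not monic in `a`, so Gauss's lemma is used: it is primitive, having constant
coefficient `1`, and over the fraction field it is a unit times `X - q^(-n)`. -/
theorem one_sub_dvd (n : ℕ) (p : Poly)
    (hp : substA (algebraMap ℤ[X] (FractionRing ℤ[X]) X ^ n)⁻¹ p = 0) :
    1 - aP * qP ^ n ∣ p := by
  have hx : algebraMap ℤ[X] (FractionRing ℤ[X]) X ^ n ≠ 0 := pow_ne_zero n algebraMap_X_ne_zero
  have hprim : (1 - aP * qP ^ n : Poly).IsPrimitive := by
    intro r hr
    have h0 := (C_dvd_iff_dvd_coeff _ _).1 hr 0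
    rw [aP, qP, ← C_pow, mul_comm, coeff_sub, coeff_one_zero, coeff_C_mul, coeff_X_zero, mul_zero,
      sub_zero] at h0
    exact isUnit_of_dvd_one h0
  refine hprim.dvd_of_fraction_map_dvd_fraction_map (K := FractionRing ℤ[X]) ?_
  have hroot : X - C (algebraMap ℤ[X] (FractionRing ℤ[X]) X ^ n)⁻¹ ∣
      p.map (algebraMap ℤ[X] (FractionRing ℤ[X])) := by
    rw [dvd_iff_isRoot, IsRoot.def, eval_map]
    exact hp
  rw [← map_pow] at hx hroot
  refine dvd_trans ⟨C (-(algebraMap ℤ[X] (FractionRing ℤ[X]) (X ^ n))⁻¹), ?_⟩ hroot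
  have hC : C (algebraMap ℤ[X] (FractionRing ℤ[X]) (X ^ n)) *
      C (algebraMap ℤ[X] (FractionRing ℤ[X]) (X ^ n))⁻¹ = 1 := by
    rw [← C_mul, mul_inv_cancel₀ hx, C_1]
  simp only [aP, qP, Polynomial.map_sub, Polynomial.map_one, Polynomial.map_mul, map_X,
    map_C, C_neg, ← C_pow]
  linear_combination -X * hC

end Linear

end Congruences

/-! ### Assembling the factors of the modulus. -/

section Main

/-- The double sum, written as a sum over pairs. -/
def doubleSum (n : ℕ) : Rat2 :=
  ∑ i ∈ Finset.range n, ∑ j ∈ Finset.range (n - i), c aF qF i * c aF qF j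

variable {ζ : ℂ}

theorem red_qInt_of_dvd {N n : ℕ} (hN : 0 < N) (hζ : IsPrimitiveRoot ζ (2 * N + 1))
    (hd : 2 * N + 1 ∣ n) : Red (substQ ζ) (qInt qF n) 0 := by
  have h := rootRed hN hζ
  have := h.red_q.qInt n
  obtain ⟨m, rfl⟩ := hd
  rwa [qInt_eq h.ne_one, pow_mul, h.prim.pow_eq_one, one_pow, sub_self, zero_div] at this

theorem C_cyclotomic_ne_zero (d : ℕ) : (C (cyclotomic d ℤ) : Poly) ≠ 0 :=
  C_ne_zero.2 (cyclotomic_ne_zero d ℤ)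

theorem substQ_C_cyclotomic {d : ℕ} (hd : 0 < d) (hζ : IsPrimitiveRoot ζ d) :
    substQ ζ (C (cyclotomic d ℤ)) = 0 := by
  have : NeZero (d : ℂ) := ⟨Nat.cast_ne_zero.2 hd.ne'⟩
  exact substQ_C_cyclotomic_eq_zero_iff.2 hζ

/-- Both sides vanish modulo `Φ_d`, so the power of `q` is irrelevant here. -/
theorem congr_cyclotomic {n d : ℕ} (hn : Odd n) (hd : d ∣ n) (hd1 : d ≠ 1) (e : ℕ) :
    Congr (C (cyclotomic d ℤ)) (doubleSum n) (qF ^ e * qInt qF n ^ 2) := by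
  obtain ⟨N, rfl⟩ := hn.of_dvd_nat hd
  have hN : 0 < N := by omega
  obtain ⟨ζ, hζ⟩ : ∃ ζ : ℂ, IsPrimitiveRoot ζ (2 * N + 1) :=
    ⟨_, Complex.isPrimitiveRoot_exp (2 * N + 1) (by omega)⟩
  have h := rootRed hN hζ
  have h2 : Red (substQ ζ) (doubleSum n - qF ^ e * qInt qF n ^ 2) 0 := by
    obtain ⟨m, rfl⟩ := hd
    simpa [doubleSum] using
      (h.red_convolution m).sub ((h.red_q.pow e).mul ((red_qInt_of_dvd hN hζ ⟨m, rfl⟩).pow 2))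
  have hker := C_cyclotomic_dvd hζ (by omega)
  have h3 := (h2.divBy hker)
  rw [← pow_one (C (cyclotomic (2 * N + 1) ℤ))] at h3 ⊢
  exact h3.congr (C_cyclotomic_ne_zero _) (substQ_C_cyclotomic (by omega) hζ) hker

theorem congr_cyclotomic_sq {N : ℕ} (hN : 0 < N) (e : ℕ) :
    Congr (C (cyclotomic (2 * N + 1) ℤ) ^ 2) (doubleSum (2 * N + 1))
      (qF ^ e * qInt qF (2 * N + 1) ^ 2) := by
  obtain ⟨ζ, hζ⟩ : ∃ ζ : ℂ, IsPrimitiveRoot ζ (2 * N + 1) :=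
    ⟨_, Complex.isPrimitiveRoot_exp (2 * N + 1) (by omega)⟩
  have h := rootRed hN hζ
  have hker := C_cyclotomic_dvd hζ (by omega)
  obtain ⟨S, Y, hS, hY, hSY⟩ := h.exists_convolution_eq
  have hq : Red (substQ ζ) (1 - qF ^ (2 * N + 1)) 0 := by
    simpa [h.prim.pow_eq_one] using (h.red_q.pow (2 * N + 1)).one_sub
  have d1 := (hS.divBy hker).mul (hS.divBy hker)
  have d2 := ((hq.divBy hker).mul (hY.divBy hker)).mul_algebraMap 2
  have hI := (red_qInt_of_dvd hN hζ dvd_rfl).divBy hker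
  have d3 := (hI.mul hI).mul_algebraMap (-qP ^ e)
  have d := (d1.add d2).add d3
  rw [← sq] at d
  refine DivBy.congr (φ := substQ ζ) ?_ (C_cyclotomic_ne_zero _)
    (substQ_C_cyclotomic (by omega) hζ) hker
  convert d using 1
  rw [doubleSum, hSY, map_neg, map_pow, map_ofNat, qF]
  ring

theorem congr_linear {P : Poly} {x : FractionRing ℤ[X]} (N : ℕ)
    (hx : x = algebraMap ℤ[X] (FractionRing ℤ[X]) X ^ (2 * N + 1) ∨
      x = (algebraMap ℤ[X] (FractionRing ℤ[X]) X ^ (2 * N + 1))⁻¹)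
    (hP : P ≠ 0) (hxP : substA x P = 0) (hker : ∀ p, substA x p = 0 → P ∣ p) :
    Congr P (doubleSum (2 * N + 1)) (qF ^ (2 * N ^ 2) * qInt qF (2 * N + 1) ^ 2) := by
  have hq : Red (substA x) qF (algebraMap ℤ[X] (FractionRing ℤ[X]) X) := by
    rw [← substA_qP x]
    exact Red.algebraMap _ _
  have ha : Red (substA x) aF x := by
    have := Red.algebraMap (K := Rat2) (substA x) aP
    rwa [substA_aP] at this
  have h := (red_convolution_sub_of_pow hq ha algebraMap_X_ne_zero algebraMap_X_pow_ne_one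
    hx).divBy hker
  rw [← pow_one P] at h ⊢
  exact h.congr hP hxP hker

theorem substQ_one_sub_ne_zero (ζ : ℂ) (n : ℕ) : substQ ζ (1 - aP * qP ^ n) ≠ 0 := by
  rw [map_sub, map_mul, map_pow, map_one, substQ_aP, substQ_qP, ← map_pow, ← map_mul,
    ← map_one (algebraMap ℂ[X] (FractionRing ℂ[X])), ← map_sub]
  exact algebraMap_ne_zero_of_eval (by simp)

theorem substQ_aP_sub_ne_zero {ζ : ℂ} (hζ : ζ ≠ 0) (n : ℕ) : substQ ζ (aP - qP ^ n) ≠ 0 := by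
  rw [map_sub, map_pow, substQ_aP, substQ_qP, ← map_pow, ← map_sub]
  exact algebraMap_ne_zero_of_eval (by simp [hζ])

theorem isRelPrime_C_cyclotomic {d : ℕ} (hd : 0 < d) {D : Poly}
    (hD : ∀ ζ : ℂ, IsPrimitiveRoot ζ d → substQ ζ D ≠ 0) :
    IsRelPrime (C (cyclotomic d ℤ)) D := by
  have hζ := Complex.isPrimitiveRoot_exp d hd.ne'
  exact isRelPrime_of_ker (C_cyclotomic_ne_zero d) (substQ_C_cyclotomic hd hζ)
    (C_cyclotomic_dvd hζ hd) (hD _ hζ)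

theorem isRelPrime_C_cyclotomic_cyclotomic {d e : ℕ} (hd : 0 < d) (he : 0 < e) (hde : d ≠ e) :
    IsRelPrime (C (cyclotomic d ℤ) : Poly) (C (cyclotomic e ℤ)) := by
  refine isRelPrime_C_cyclotomic hd fun ζ hζ h => hde ?_
  have : NeZero (e : ℂ) := ⟨Nat.cast_ne_zero.2 he.ne'⟩
  exact hζ.unique (substQ_C_cyclotomic_eq_zero_iff.1 h)

theorem modulus_eq {n : ℕ} (hn : 1 < n) :
    modulus n = (∏ d ∈ n.properDivisors.erase 1, C (cyclotomic d ℤ)) * C (cyclotomic n ℤ) ^ 2 *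
      (1 - aP * qP ^ n) * (aP - qP ^ n) := by
  have h1 : qInt qP n = C (∏ d ∈ n.divisors.erase 1, cyclotomic d ℤ) := by
    rw [prod_cyclotomic_eq_geom_sum (by omega), map_sum]
    simp [qInt, qP]
  have h2 : n.divisors.erase 1 = insert n (n.properDivisors.erase 1) := by
    rw [← Nat.insert_self_properDivisors (by omega), Finset.erase_insert_of_ne (by omega)]
  rw [modulus, h1, h2, Finset.prod_insert (by simp), map_mul, map_prod]
  ring

theorem congr_modulus (N : ℕ) :
    Congr (modulus (2 * N + 1)) (doubleSum (2 * N + 1))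
      (qF ^ (2 * N ^ 2) * qInt qF (2 * N + 1) ^ 2) := by
  -- For `n = 1` both sides equal `1`; the factorization of the modulus used below needs `n > 1`.
  rcases Nat.eq_zero_or_pos N with rfl | hN
  · exact ⟨0, 1, one_ne_zero, isRelPrime_one_left, by simp [doubleSum, c, qPoch, qInt]⟩
  have hz := algebraMap_X_ne_zero
  set n := 2 * N + 1 with hn
  have hzn := pow_ne_zero n hz
  have hmem : ∀ d ∈ n.properDivisors.erase 1, d ∣ n ∧ d < n ∧ d ≠ 1 ∧ 0 < d := fun d hd => by
    rw [Finset.mem_erase, Nat.mem_properDivisors] at hd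
    exact ⟨hd.2.1, hd.2.2, hd.1, Nat.pos_of_dvd_of_pos hd.2.1 (by omega)⟩
  have s1 : substA (algebraMap ℤ[X] (FractionRing ℤ[X]) X ^ n)⁻¹ (1 - aP * qP ^ n) = 0 := by
    rw [map_sub, map_mul, map_pow, map_one, substA_aP, substA_qP, inv_mul_cancel₀ hzn, sub_self]
  have s2 : substA (algebraMap ℤ[X] (FractionRing ℤ[X]) X ^ n) (aP - qP ^ n) = 0 := by
    rw [map_sub, map_pow, substA_aP, substA_qP, sub_self]
  -- At `a = q^n` the other linear factor becomes `1 - q^(2n)`, so the two are coprime.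
  have s3 : substA (algebraMap ℤ[X] (FractionRing ℤ[X]) X ^ n) (1 - aP * qP ^ n) ≠ 0 := by
    rw [map_sub, map_mul, map_pow, map_one, substA_aP, substA_qP, ← pow_add]
    exact sub_ne_zero.2 (algebraMap_X_pow_ne_one _ (by omega)).symm
  have n2 : (aP - qP ^ n : Poly) ≠ 0 := fun h =>
    substQ_aP_sub_ne_zero one_ne_zero n (by rw [h, map_zero])
  have n1 : (1 - aP * qP ^ n : Poly) ≠ 0 := fun h =>
    substQ_one_sub_ne_zero 1 n (by rw [h, map_zero])
  have r1 : ∀ d, 0 < d → IsRelPrime (C (cyclotomic d ℤ)) (1 - aP * qP ^ n) := fun d hd =>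
    isRelPrime_C_cyclotomic hd fun ζ _ => substQ_one_sub_ne_zero ζ n
  have r2 : ∀ d, 0 < d → IsRelPrime (C (cyclotomic d ℤ)) (aP - qP ^ n) := fun d hd =>
    isRelPrime_C_cyclotomic hd fun ζ hζ => substQ_aP_sub_ne_zero (hζ.ne_zero hd.ne') n
  rw [modulus_eq (by omega)]
  refine (((Congr.prod (fun d hd => ?_) ?_).mul (congr_cyclotomic_sq hN _) ?_).mul
    (congr_linear N (Or.inr rfl) n1 s1 (one_sub_dvd n)) ?_).mul
    (congr_linear N (Or.inl rfl) n2 s2 (aP_sub_dvd n)) ?_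
  · exact congr_cyclotomic ⟨N, rfl⟩ (hmem d hd).1 (hmem d hd).2.2.1 _
  · intro d hd e he hde
    exact isRelPrime_C_cyclotomic_cyclotomic (hmem d hd).2.2.2 (hmem e he).2.2.2 hde
  · refine IsRelPrime.prod_left fun d hd => IsRelPrime.pow_right ?_
    exact isRelPrime_C_cyclotomic_cyclotomic (hmem d hd).2.2.2 (by omega) (hmem d hd).2.1.ne
  · exact (IsRelPrime.prod_left fun d hd => r1 d (hmem d hd).2.2.2).mul_left
      (r1 n (by omega)).pow_left
  · refine ((IsRelPrime.prod_left fun d hd => r2 d (hmem d hd).2.2.2).mul_left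
      (r2 n (by omega)).pow_left).mul_left ?_
    exact (isRelPrime_of_ker n2 s2 (aP_sub_dvd n) s3).symm

end Main

end QCongruence

end

theorem mainTheorem4 (n : ℕ) (hn : Odd n) :
    QCongruence.Congr (QCongruence.modulus n)
      (∑ k ∈ Finset.range n, ∑ j ∈ Finset.range (k + 1),
        QCongruence.c QCongruence.aF QCongruence.qF j *
          QCongruence.c QCongruence.aF QCongruence.qF (k - j))
      (QCongruence.qF ^ ((n - 1) ^ 2 / 2) * QCongruence.qInt QCongruence.qF n ^ 2) := by
  obtain ⟨N, rfl⟩ := hn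
  have he : (2 * N + 1 - 1) ^ 2 / 2 = 2 * N ^ 2 := by
    rw [Nat.add_sub_cancel, show (2 * N) ^ 2 = 2 * (2 * N ^ 2) by ring]
    exact Nat.mul_div_cancel_left _ two_pos
  rw [he, Finset.sum_range_diag_flip (2 * N + 1) fun i j =>
    QCongruence.c QCongruence.aF QCongruence.qF i * QCongruence.c QCongruence.aF QCongruence.qF j]
  exact QCongruence.congr_modulus N
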